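/- Let $m,n\ge 1$, let $a_1,\dots,a_m$ be distinct points and $b_1,\dots,b_n$ be distinct points of the open unit disk $\mathbb D$, and let $$\alpha(z)=\prod_{i=1}^{m}\frac{a_i-z}{1-\overline{a_i}z},\qquad \beta(z)=\prod_{j=1}^{n}\frac{b_j-z}{1-\overline{b_j}z}$$ be the finite Blaschke products with these zeros. Assume that $\alpha$ and $\beta$ have precisely $l\ge 0$ zeros in common, namely $a_i=b_i$ for $i\le l$. Let $H^2\subset L^2(\partial\mathbb D)$ be the Hardy space, $K_\alpha=H^2\ominus\alpha H^2$ and $K_\beta=H^2\ominus\beta H^2$ the model spaces, and $P_\beta$ the orthogonal projection of $L^2(\partial\mathbb D)$ onto $K_\beta$. Let $\mathcal T(\alpha,\beta)$ be the set of all (bounded) asymmetric truncated Toeplitz operators $A_\varphi^{\alpha,\beta}:K_\alpha\to K_\beta$, $A_\varphi^{\alpha,\beta}f=P_\beta(\varphi f)$, with symbol $\varphi\in L^2(\partial\mathbb D)$. For $w\in\mathbb D$ put $k_w^{\alpha}(z)=\dfrac{1-\overline{\alpha(w)}\alpha(z)}{1-\overline wz}$, and similarly $k_w^\beta$. Then $\{k_{a_1}^\alpha,\dots,k_{a_m}^\alpha\}$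 is a basis of $K_\alpha$ and $\{k_{b_1}^\beta,\dots,k_{b_n}^\beta\}$ is a basis of $K_\beta$. Let $A:K_\alpha\to K_\beta$ be any linear transformation and let $(r_{s,p})$, $1\le s\le n$, $1\le p\le m$, be its matrix with respect to these bases, that is, $Ak_{a_p}^\alpha=\sum_{s=1}^n r_{s,p}k_{b_s}^\beta$. (a) If $l=0$, then $A\in\mathcal T(\alpha,\beta)$ if and only if $$r_{s,p}=\frac{\overline{\beta'(b_s)}(\overline{a_1}-\overline{b_s})r_{s,1}+\overline{\beta'(b_1)}(\overline{b_1}-\overline{a_1})r_{1,1}+\overline{\beta'(b_1)}(\overline{a_p}-\overline{b_1})r_{1,p}}{\overline{\beta'(b_s)}(\overline{a_p}-\overline{b_s})}$$ for all $1\le p\le m$ and $1\le s\le n$. In particular, an operator in $\mathcal T(\alpha,\beta)$ is uniquely determined by the first row and the first column of its matrix. (b) If $l>0$, then $A\in\mathcal T(\alpha,\beta)$ if and only if $$r_{s,p}=\frac{\overline{\beta'(b_1)}(\overline{a_1}-\overline{b_s})r_{1,s}+\overline{\beta'(b_1)}(\overline{a_p}-\overline{b_1})r_{1,p}}{\overline{\beta'(b_s)}(\overline{a_p}-\overline{b_s})}$$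 for all $1\le p\le m$, $1\le s\le l$ with $s\ne p$, and $$r_{s,p}=\frac{\overline{\beta'(b_s)}(\overline{a_1}-\overline{b_s})r_{s,1}+\overline{\beta'(b_1)}(\overline{a_p}-\overline{b_1})r_{1,p}}{\overline{\beta'(b_s)}(\overline{a_p}-\overline{b_s})}$$ for all $1\le p\le m$, $l<s\le n$. In particular, an operator in $\mathcal T(\alpha,\beta)$ is uniquely determined by the first row, the first $l$ diagonal entries and the last $n-l$ entries of the first column of its matrix. -/

import Mathlib

open MeasureTheory AddCircle
open scoped ComplexConjugate ENNReal Real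

noncomputable section

instance fact_two_pi_pos : Fact ((0 : ℝ) < 2 * π) := ⟨Real.two_pi_pos⟩

/-- The unit circle `∂𝔻`, parametrised by `t ↦ e^{it}`, `t ∈ ℝ / 2πℤ`. -/
abbrev UCircle : Type := AddCircle (2 * π)

/-- Normalised Lebesgue measure `dt / 2π` on the unit circle. -/
abbrev circleMeasure : Measure UCircle := haarAddCircle

/-- The Hilbert space `L²(∂𝔻)`. -/
abbrev LTwo : Type := Lp ℂ 2 circleMeasure

/-- The function `g` on the closed disk, restricted to the circle: `t ↦ g (e^{it})`. -/
def onCircle (g : ℂ → ℂ) (t : UCircle) : ℂ := g (toCircle t : ℂ)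

/-- The Hardy space `H²`, as the closed subspace of `L²(∂𝔻)` of the functions whose Fourier
coefficients of negative index vanish. -/
def hardySpace : Submodule ℂ LTwo where
  carrier := {f | ∀ k : ℤ, k < 0 → fourierCoeff (f : UCircle → ℂ) k = 0}
  zero_mem' := by
    intro k _
    rw [← fourierBasis_repr]
    simp
  add_mem' := by
    intro f g hf hg k hk
    have h1 := hf k hk
    have h2 := hg k hk
    rw [← fourierBasis_repr] at h1 h2 ⊢
    simp [h1, h2]
  smul_mem' := by
    intro c f hf k hk
    have h1 := hf k hk
    rw [← fourierBasis_repr] at h1 ⊢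
    simp [h1]

theorem isClosed_hardySpace : IsClosed (hardySpace : Set LTwo) := by
  have h : (hardySpace : Set LTwo) =
      ⋂ (k : ℤ) (_ : k < 0), {f : LTwo | inner ℂ (fourierBasis (T := 2 * π) k) f = (0 : ℂ)} := by
    ext f
    simp only [hardySpace, Submodule.coe_set_mk, AddSubmonoid.coe_set_mk, Set.mem_iInter,
      AddSubsemigroup.coe_set_mk, Set.mem_ofPred_eq]
    refine forall_congr' fun k => forall_congr' fun _ => ?_
    rw [← fourierBasis_repr, HilbertBasis.repr_apply_apply]
  rw [h]
  refine isClosed_iInter fun k => isClosed_iInter fun _ => ?_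
  exact isClosed_eq (by fun_prop) continuous_const

/-- The subspace `α H²` of `L²(∂𝔻)`. -/
def mulHardySpace (α : ℂ → ℂ) : Submodule ℂ LTwo where
  carrier := {f | ∃ h ∈ hardySpace,
    (f : UCircle → ℂ) =ᵐ[circleMeasure] fun t => onCircle α t * h t}
  zero_mem' := by
    refine ⟨0, zero_mem _, ?_⟩
    filter_upwards [Lp.coeFn_zero ℂ 2 circleMeasure] with t ht
    rw [ht]
    simp
  add_mem' := by
    rintro f g ⟨h, hh, hf⟩ ⟨k, hk, hg⟩
    refine ⟨h + k, add_mem hh hk, ?_⟩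
    filter_upwards [hf, hg, Lp.coeFn_add f g, Lp.coeFn_add h k] with t h1 h2 h3 h4
    simp only [h3, h4, Pi.add_apply, h1, h2]
    ring
  smul_mem' := by
    rintro c f ⟨h, hh, hf⟩
    refine ⟨c • h, Submodule.smul_mem _ c hh, ?_⟩
    filter_upwards [hf, Lp.coeFn_smul c f, Lp.coeFn_smul c h] with t h1 h2 h3
    simp only [h2, h3, Pi.smul_apply, h1, smul_eq_mul]
    ring

/-- The model space `K_α = H² ⊖ α H²`. -/
def modelSpace (α : ℂ → ℂ) : Submodule ℂ LTwo :=
  hardySpace ⊓ (mulHardySpace α)ᗮ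

instance completeSpace_modelSpace (α : ℂ → ℂ) : CompleteSpace (modelSpace α) := by
  have h : IsClosed (modelSpace α : Set LTwo) := by
    rw [modelSpace, Submodule.coe_inf]
    exact isClosed_hardySpace.inter (Submodule.isClosed_orthogonal _)
  exact h.completeSpace_coe

/-- The product `φ f ∈ L²(∂𝔻)` of `φ ∈ L²(∂𝔻)` and an essentially bounded `f`. -/
def mulBounded (φ f : LTwo) (hf : MemLp (f : UCircle → ℂ) ∞ circleMeasure) : LTwo :=
  MemLp.toLp (fun t => φ t * f t) (hf.mul (Lp.memLp φ))

/-- The class `𝒯(α, β)` of bounded asymmetric truncated Toeplitz operators: the bounded operators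
`A : K_α → K_β` for which there is a symbol `φ ∈ L²(∂𝔻)` with `A f = P_β (φ f)` for all bounded
`f ∈ K_α`, where `P_β` is the orthogonal projection of `L²(∂𝔻)` onto `K_β`.
(Bounded functions are dense in `K_α`; if `α` is a finite Blaschke product, every function in `K_α`
is bounded.) -/
def asymTruncToeplitz (α β : ℂ → ℂ) : Set (modelSpace α →ₗ[ℂ] modelSpace β) :=
  {A | Continuous A ∧ ∃ φ : LTwo, ∀ (f : modelSpace α)
    (hf : MemLp ((f : LTwo) : UCircle → ℂ) ∞ circleMeasure),
      A f = (modelSpace β).orthogonalProjectionOnto (mulBounded φ f hf)}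

/-- The finite Blaschke product with zeros `a i`. -/
def blaschke {m : ℕ} (a : Fin m → ℂ) (z : ℂ) : ℂ :=
  ∏ i, (a i - z) / (1 - conj (a i) * z)

/-- The reproducing kernel `k_w^α` of `K_α`. -/
def modelKernel (α : ℂ → ℂ) (w z : ℂ) : ℂ :=
  (1 - conj (α w) * α z) / (1 - conj w * z)

end

/-! At a zero of the Blaschke product the model kernel is the Szegő kernel `S_w = 1/(1 - w̄z)`. The
functions `β/(z - b_s)` of `K_β` are biorthogonal to the `S_{b_s}` up to the factor `β'(b_s)`, and
on the circle their conjugates are `β̄ z S_{b_s}`. With `ψ = β̄φ`, the operator with symbol `φ` thus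
has entries `conj β'(b_s) r_{s,p} = ∫ ψ z S_{b_s} S_{a_p}`. As `|β| = 1` on the circle, `ψ` ranges
over all of `L²`.

Since `(x̄ - ȳ) z S_x S_y = S_x - S_y`, the weighted entry `conj β'(b_s) (ā_p - b̄_s) r_{s,p}` is a
difference `F(a_p) - F(b_s)`. Conversely, a matrix of this form comes from `ψ = q̄`, where the
polynomial `q` takes the values `conj F` at all nodes and has derivatives at the common zeros that
produce the entries left free there by the difference condition
(`mem_asymTruncToeplitz_iff_exists_difference`). Eliminating `F` is then algebra and yields the
formulas of (a) and (b).

Analytic functions on the disk are avoided: membership in `H²` is the vanishing of moments, and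
evaluation at `w` is pairing with `S_w`. -/

noncomputable section

/-! ### Hardy space on the circle: moments, Szegő kernels, multipliers. -/

/-- The Szegő kernel `z ↦ 1 / (1 - w̄ z)`, the reproducing kernel of `H²` at `w`. -/
def szegoKernel (w z : ℂ) : ℂ := (1 - conj w * z)⁻¹

/-- Functions on the circle representing elements of the Hardy space. -/
structure IsHardy (f : UCircle → ℂ) : Prop where
  memLp : MemLp f 2 circleMeasure
  moment : ∀ k : ℕ, ∫ t, (toCircle t : ℂ) ^ (k + 1) * f t ∂circleMeasure = 0

/-- Functions `g` that multiply the Hardy space into itself, compatibly with evaluation at the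
points of the disk. -/
structure IsHardyMultiplier (g : ℂ → ℂ) : Prop where
  continuous_onCircle : Continuous (onCircle g)
  mul : ∀ f, IsHardy f → IsHardy fun t => onCircle g t * f t
  eval : ∀ f, IsHardy f → ∀ w, ‖w‖ < 1 →
    ∫ t, conj (onCircle (szegoKernel w) t) * (onCircle g t * f t) ∂circleMeasure =
      g w * ∫ t, conj (onCircle (szegoKernel w) t) * f t ∂circleMeasure

theorem norm_toCircle (t : UCircle) : ‖(toCircle t : ℂ)‖ = 1 := Circle.norm_coe _

theorem toCircle_ne_zero (t : UCircle) : (toCircle t : ℂ) ≠ 0 := Circle.coe_ne_zero _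

theorem conj_toCircle (t : UCircle) : conj (toCircle t : ℂ) = (toCircle t : ℂ)⁻¹ := by
  rw [← Circle.coe_inv_eq_conj, Circle.coe_inv]

theorem continuous_coe_toCircle : Continuous fun t : UCircle => (toCircle t : ℂ) :=
  continuous_subtype_val.comp continuous_toCircle

theorem continuous_coe_toCircle_pow (k : ℕ) :
    Continuous fun t : UCircle => (toCircle t : ℂ) ^ k :=
  continuous_coe_toCircle.pow k

theorem toCircle_sub_ne_zero {w : ℂ} (hw : ‖w‖ < 1) (t : UCircle) :
    (toCircle t : ℂ) - w ≠ 0 := by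
  intro h
  rw [← sub_eq_zero.1 h, norm_toCircle] at hw
  exact lt_irrefl _ hw

theorem one_sub_conj_mul_ne_zero {w z : ℂ} (hw : ‖w‖ < 1) (hz : ‖z‖ ≤ 1) :
    1 - conj w * z ≠ 0 := by
  intro h
  have h1 : ‖conj w * z‖ = 1 := by rw [← sub_eq_zero.1 h, norm_one]
  rw [norm_mul, RCLike.norm_conj] at h1
  nlinarith [norm_nonneg w, norm_nonneg z]

theorem one_sub_conj_mul_toCircle_ne_zero {w : ℂ} (hw : ‖w‖ < 1) (t : UCircle) :
    1 - conj w * (toCircle t : ℂ) ≠ 0 :=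
  one_sub_conj_mul_ne_zero hw (norm_toCircle t).le

theorem continuous_szegoKernel {w : ℂ} (hw : ‖w‖ < 1) : Continuous (onCircle (szegoKernel w)) := by
  unfold onCircle szegoKernel
  exact (continuous_const.sub (continuous_const.mul continuous_coe_toCircle)).inv₀
    (one_sub_conj_mul_toCircle_ne_zero hw)

theorem conj_szegoKernel {w : ℂ} (hw : ‖w‖ < 1) (t : UCircle) :
    conj (onCircle (szegoKernel w) t) = (toCircle t : ℂ) / (toCircle t - w) := by
  have h1 := toCircle_sub_ne_zero hw t
  have h2 := toCircle_ne_zero t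
  have h3 : 1 - w * (toCircle t : ℂ)⁻¹ = ((toCircle t : ℂ) - w) / toCircle t := by
    field_simp
  simp only [onCircle, szegoKernel, map_inv₀, map_sub, map_one, map_mul, Complex.conj_conj,
    conj_toCircle, h3, inv_div]

theorem memLp_of_continuous {g : UCircle → ℂ} (hg : Continuous g) (p : ℝ≥0∞) :
    MemLp g p circleMeasure :=
  hg.memLp_of_hasCompactSupport (HasCompactSupport.of_compactSpace g)

theorem memLp_continuous_mul {f g : UCircle → ℂ} (hg : Continuous g)
    (hf : MemLp f 2 circleMeasure) : MemLp (fun t => g t * f t) 2 circleMeasure :=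
  hf.mul (memLp_of_continuous hg ∞)

theorem integrable_continuous_mul {f g : UCircle → ℂ} (hg : Continuous g)
    (hf : MemLp f 2 circleMeasure) : Integrable (fun t => g t * f t) circleMeasure :=
  (memLp_continuous_mul hg hf).integrable (by norm_num)

theorem norm_integral_toCircle_pow_mul_le (f : UCircle → ℂ) (k : ℕ) :
    ‖∫ t, (toCircle t : ℂ) ^ k * f t ∂circleMeasure‖ ≤ ∫ t, ‖f t‖ ∂circleMeasure := by
  refine (norm_integral_le_integral_norm _).trans_eq ?_
  simp [norm_toCircle]

namespace IsHardy

theorem add {f g : UCircle → ℂ} (hf : IsHardy f) (hg : IsHardy g) :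
    IsHardy fun t => f t + g t where
  memLp := hf.memLp.add hg.memLp
  moment k := by
    simp only [mul_add]
    rw [integral_add (integrable_continuous_mul (continuous_coe_toCircle_pow _) hf.memLp)
      (integrable_continuous_mul (continuous_coe_toCircle_pow _) hg.memLp), hf.moment, hg.moment,
      add_zero]

theorem const_mul {f : UCircle → ℂ} (hf : IsHardy f) (c : ℂ) : IsHardy fun t => c * f t where
  memLp := hf.memLp.const_mul c
  moment k := by
    simp only [mul_left_comm _ c]
    rw [integral_const_mul, hf.moment, mul_zero]

theorem congr {f g : UCircle → ℂ} (hf : IsHardy f) (h : f =ᵐ[circleMeasure] g) : IsHardy g where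
  memLp := hf.memLp.ae_eq h
  moment k := by
    rw [← hf.moment k]
    refine integral_congr_ae ?_
    filter_upwards [h] with t ht
    rw [ht]

theorem sum {ι : Type*} {f : ι → UCircle → ℂ} {s : Finset ι} (hf : ∀ i ∈ s, IsHardy (f i)) :
    IsHardy fun t => ∑ i ∈ s, f i t := by
  classical
  induction s using Finset.induction_on with
  | empty => exact ⟨by simp, by simp⟩
  | insert i s hi ih =>
    simp only [Finset.sum_insert hi]
    exact (hf i (by simp)).add (ih fun j hj => hf j (by simp [hj]))

theorem one : IsHardy fun _ => 1 where
  memLp := memLp_const _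
  moment k := by
    have h2 : inner ℂ (ContinuousMap.toLp 2 circleMeasure ℂ (fourier (T := 2 * π) 0))
        (ContinuousMap.toLp 2 circleMeasure ℂ (fourier (T := 2 * π) ((k : ℤ) + 1))) = 0 :=
      (orthonormal_fourier (T := 2 * π)).2 (by omega)
    rw [ContinuousMap.inner_toLp] at h2
    rw [← h2]
    refine integral_congr_ae (Filter.Eventually.of_forall fun t => ?_)
    have h3 : (fourier ((k : ℤ) + 1) t : ℂ) = (toCircle t : ℂ) ^ (k + 1) := by
      rw [fourier_apply, toCircle_zsmul]
      norm_cast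
    simp only [h3]
    simp

theorem toCircle_mul {f : UCircle → ℂ} (hf : IsHardy f) :
    IsHardy fun t => (toCircle t : ℂ) * f t where
  memLp := memLp_continuous_mul continuous_coe_toCircle hf.memLp
  moment k := by
    rw [← hf.moment (k + 1)]
    simp only [pow_succ, mul_assoc]

/-- From `(1 - āz) g = f` the moments of `g` satisfy `M_k = ā M_{k+1}`. Iterating, `|M_k| ≤ |a|^j
‖g‖₁` for every `j`, which tends to zero. -/
theorem szegoKernel_mul {f : UCircle → ℂ} (hf : IsHardy f) {a : ℂ} (ha : ‖a‖ < 1) :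
    IsHardy fun t => onCircle (szegoKernel a) t * f t := by
  set g : UCircle → ℂ := fun t => onCircle (szegoKernel a) t * f t with hg
  have hg2 : MemLp g 2 circleMeasure := memLp_continuous_mul (continuous_szegoKernel ha) hf.memLp
  refine ⟨hg2, ?_⟩
  have hint : ∀ k : ℕ, Integrable (fun t => (toCircle t : ℂ) ^ k * g t) circleMeasure :=
    fun k => integrable_continuous_mul (continuous_coe_toCircle_pow _) hg2
  have hstep : ∀ k : ℕ, ∫ t, (toCircle t : ℂ) ^ (k + 1) * g t ∂circleMeasure =
      conj a * ∫ t, (toCircle t : ℂ) ^ (k + 1 + 1) * g t ∂circleMeasure := by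
    intro k
    rw [← sub_eq_zero, ← integral_const_mul, ← integral_sub (hint _) ((hint _).const_mul _),
      ← hf.moment k]
    congr 1 with t
    have := one_sub_conj_mul_toCircle_ne_zero ha t
    simp only [hg, onCircle, szegoKernel]
    field_simp
    ring
  have hiter : ∀ k j : ℕ, ∫ t, (toCircle t : ℂ) ^ (k + 1) * g t ∂circleMeasure =
      conj a ^ j * ∫ t, (toCircle t : ℂ) ^ (k + j + 1) * g t ∂circleMeasure := by
    intro k j
    induction j with
    | zero => simp
    | succ j ih => rw [ih, hstep, pow_succ, mul_assoc, add_assoc k j 1]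
  intro k
  have hlim : Filter.Tendsto (fun j : ℕ => ‖a‖ ^ j * ∫ t, ‖g t‖ ∂circleMeasure) Filter.atTop
      (nhds (0 * ∫ t, ‖g t‖ ∂circleMeasure)) :=
    (tendsto_pow_atTop_nhds_zero_of_lt_one (norm_nonneg _) ha).mul_const _
  rw [zero_mul] at hlim
  rw [← norm_le_zero_iff]
  refine ge_of_tendsto hlim (Filter.Eventually.of_forall fun j => ?_)
  rw [hiter k j, norm_mul, norm_pow, RCLike.norm_conj]
  gcongr
  exact norm_integral_toCircle_pow_mul_le _ _

theorem integral_toCircle_mul {f : UCircle → ℂ} (hf : IsHardy f) :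
    ∫ t, (toCircle t : ℂ) * f t ∂circleMeasure = 0 := by
  simpa using hf.moment 0

/-- An element of `H²` vanishing at `w` can be divided by `w - z`. -/
theorem div_sub {f : UCircle → ℂ} (hf : IsHardy f) {w : ℂ} (hw : ‖w‖ < 1)
    (h0 : ∫ t, conj (onCircle (szegoKernel w) t) * f t ∂circleMeasure = 0) :
    IsHardy fun t => (w - toCircle t)⁻¹ * f t := by
  set g : UCircle → ℂ := fun t => (w - toCircle t)⁻¹ * f t with hg
  have hne : ∀ t : UCircle, w - (toCircle t : ℂ) ≠ 0 := fun t h =>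
    toCircle_sub_ne_zero hw t (by rw [← neg_sub, h, neg_zero])
  have hg2 : MemLp g 2 circleMeasure :=
    memLp_continuous_mul ((continuous_const.sub continuous_coe_toCircle).inv₀ hne) hf.memLp
  refine ⟨hg2, fun k => ?_⟩
  have hint : ∀ k : ℕ, Integrable (fun t => (toCircle t : ℂ) ^ k * g t) circleMeasure :=
    fun k => integrable_continuous_mul (continuous_coe_toCircle_pow _) hg2
  induction k with
  | zero =>
    -- On the circle `z/(z - w)` is the conjugate Szegő kernel, so the first moment of `g` is minus
    -- the evaluation of `f` at `w`.
    rw [← neg_eq_zero, ← integral_neg, ← h0]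
    congr 1 with t
    rw [conj_szegoKernel hw, hg, ← neg_sub w]
    have := hne t
    field_simp
    rw [zero_add, pow_one]
  | succ k ih =>
    -- As `(w - z) g = f` has zero moments, each moment of `g` is `w` times the previous one.
    have h1 : w * ∫ t, (toCircle t : ℂ) ^ (k + 1) * g t ∂circleMeasure -
        ∫ t, (toCircle t : ℂ) ^ (k + 1 + 1) * g t ∂circleMeasure = 0 := by
      rw [← integral_const_mul, ← integral_sub ((hint _).const_mul _) (hint _), ← hf.moment k]
      congr 1 with t
      have := hne t
      simp only [hg]
      field_simp
      ring
    rw [ih, mul_zero, zero_sub, neg_eq_zero] at h1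
    exact h1

end IsHardy

theorem isHardy_szegoKernel {w : ℂ} (hw : ‖w‖ < 1) : IsHardy (onCircle (szegoKernel w)) := by
  simpa using IsHardy.one.szegoKernel_mul hw

theorem integrable_conj_szegoKernel_mul {w : ℂ} (hw : ‖w‖ < 1) {f : UCircle → ℂ}
    (hf : MemLp f 2 circleMeasure) :
    Integrable (fun t => conj (onCircle (szegoKernel w) t) * f t) circleMeasure :=
  integrable_continuous_mul (Complex.continuous_conj.comp (continuous_szegoKernel hw)) hf

theorem integral_conj_szegoKernel_mul_toCircle_sub {w : ℂ} (hw : ‖w‖ < 1) {f : UCircle → ℂ}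
    (hf : IsHardy f) :
    ∫ t, conj (onCircle (szegoKernel w) t) * (((toCircle t : ℂ) - w) * f t) ∂circleMeasure = 0 := by
  rw [← hf.integral_toCircle_mul]
  congr 1 with t
  have := toCircle_sub_ne_zero hw t
  rw [conj_szegoKernel hw]
  field_simp

theorem integral_szegoKernel {w : ℂ} (hw : ‖w‖ < 1) :
    ∫ t, onCircle (szegoKernel w) t ∂circleMeasure = 1 := by
  have hS := isHardy_szegoKernel hw
  -- The kernel is `1` plus `w̄ z` times itself, and the latter term has mean zero.
  have h1 : ∫ t, (onCircle (szegoKernel w) t -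
      conj w * ((toCircle t : ℂ) * onCircle (szegoKernel w) t)) ∂circleMeasure = 1 := by
    have h2 : ∀ t, onCircle (szegoKernel w) t -
        conj w * ((toCircle t : ℂ) * onCircle (szegoKernel w) t) = 1 := by
      intro t
      have := one_sub_conj_mul_toCircle_ne_zero hw t
      simp only [onCircle, szegoKernel]
      field_simp
    simp [h2]
  rw [integral_sub (hS.memLp.integrable (by norm_num))
    ((hS.toCircle_mul.memLp.integrable (by norm_num)).const_mul _), integral_const_mul,
    hS.integral_toCircle_mul, mul_zero, sub_zero] at h1
  exact h1

theorem integral_conj_szegoKernel {w : ℂ} (hw : ‖w‖ < 1) :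
    ∫ t, conj (onCircle (szegoKernel w) t) ∂circleMeasure = 1 := by
  rw [integral_conj, integral_szegoKernel hw, map_one]

namespace IsHardyMultiplier

theorem isHardy {g : ℂ → ℂ} (hg : IsHardyMultiplier g) : IsHardy (onCircle g) := by
  simpa using hg.mul _ IsHardy.one

theorem integral_conj_szegoKernel_mul {g : ℂ → ℂ} (hg : IsHardyMultiplier g) {w : ℂ}
    (hw : ‖w‖ < 1) :
    ∫ t, conj (onCircle (szegoKernel w) t) * onCircle g t ∂circleMeasure = g w := by
  simpa [integral_conj_szegoKernel hw] using hg.eval _ IsHardy.one w hw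

theorem const (c : ℂ) : IsHardyMultiplier fun _ => c where
  continuous_onCircle := continuous_const
  mul f hf := hf.const_mul c
  eval f hf w hw := by
    rw [← integral_const_mul]
    simp only [onCircle, mul_left_comm]

theorem add {g h : ℂ → ℂ} (hg : IsHardyMultiplier g) (hh : IsHardyMultiplier h) :
    IsHardyMultiplier fun z => g z + h z where
  continuous_onCircle := hg.continuous_onCircle.add hh.continuous_onCircle
  mul f hf := by
    simpa only [onCircle, add_mul] using (hg.mul f hf).add (hh.mul f hf)
  eval f hf w hw := by
    rw [add_mul, ← hg.eval f hf w hw, ← hh.eval f hf w hw,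
      ← integral_add (integrable_conj_szegoKernel_mul hw (hg.mul f hf).memLp)
        (integrable_conj_szegoKernel_mul hw (hh.mul f hf).memLp)]
    simp only [onCircle, add_mul, mul_add]

theorem mul' {g h : ℂ → ℂ} (hg : IsHardyMultiplier g) (hh : IsHardyMultiplier h) :
    IsHardyMultiplier fun z => g z * h z where
  continuous_onCircle := hg.continuous_onCircle.mul hh.continuous_onCircle
  mul f hf := by
    simpa only [onCircle, mul_assoc] using hg.mul _ (hh.mul f hf)
  eval f hf w hw := by
    rw [mul_assoc, ← hh.eval f hf w hw, ← hg.eval _ (hh.mul f hf) w hw]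
    simp only [onCircle, mul_assoc]

theorem id : IsHardyMultiplier fun z => z where
  continuous_onCircle := continuous_coe_toCircle
  mul f hf := hf.toCircle_mul
  eval f hf w hw := by
    change ∫ t, conj (onCircle (_root_.szegoKernel w) t) * ((toCircle t : ℂ) * f t) ∂circleMeasure = _
    rw [← sub_eq_zero, ← integral_const_mul, ← integral_sub
      (integrable_conj_szegoKernel_mul hw hf.toCircle_mul.memLp)
      ((integrable_conj_szegoKernel_mul hw hf.memLp).const_mul _),
      ← integral_conj_szegoKernel_mul_toCircle_sub hw hf]
    congr 1 with t
    simp only [onCircle]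
    ring

theorem prod {ι : Type*} {g : ι → ℂ → ℂ} {s : Finset ι}
    (hg : ∀ i ∈ s, IsHardyMultiplier (g i)) : IsHardyMultiplier fun z => ∏ i ∈ s, g i z := by
  classical
  induction s using Finset.induction_on with
  | empty => simpa using const 1
  | insert i s hi ih =>
    simp only [Finset.prod_insert hi]
    exact (hg i (by simp)).mul' (ih fun j hj => hg j (by simp [hj]))

theorem polynomial (q : Polynomial ℂ) : IsHardyMultiplier fun z => q.eval z := by
  induction q using Polynomial.induction_on' with
  | add p q hp hq => simpa using hp.add hq
  | monomial k c =>
    simp only [Polynomial.eval_monomial]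
    refine (const c).mul' ?_
    induction k with
    | zero => simpa using const 1
    | succ k ih =>
      simp only [pow_succ]
      exact ih.mul' id

theorem szegoKernel {a : ℂ} (ha : ‖a‖ < 1) : IsHardyMultiplier (szegoKernel a) where
  continuous_onCircle := continuous_szegoKernel ha
  mul f hf := hf.szegoKernel_mul ha
  eval f hf w hw := by
    set g : UCircle → ℂ := fun t => onCircle (_root_.szegoKernel a) t * f t with hg
    have hgH : IsHardy g := hf.szegoKernel_mul ha
    have hid : ∫ t, conj (onCircle (_root_.szegoKernel w) t) * ((toCircle t : ℂ) * g t)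
        ∂circleMeasure = _ := id.eval g hgH w hw
    -- Evaluating `f = g - āzg` at `w` gives `f(w) = (1 - āw) g(w)`.
    have h1 : ∫ t, conj (onCircle (_root_.szegoKernel w) t) * f t ∂circleMeasure =
        (1 - conj a * w) *
          ∫ t, conj (onCircle (_root_.szegoKernel w) t) * g t ∂circleMeasure := by
      rw [sub_mul, one_mul, mul_assoc, ← hid, ← integral_const_mul, ← integral_sub
        (integrable_conj_szegoKernel_mul hw hgH.memLp)
        ((integrable_conj_szegoKernel_mul hw hgH.toCircle_mul.memLp).const_mul _)]
      congr 1 with t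
      have hfg : f t = g t - conj a * ((toCircle t : ℂ) * g t) := by
        have := one_sub_conj_mul_toCircle_ne_zero ha t
        simp only [hg, onCircle, _root_.szegoKernel]
        field_simp
      rw [hfg]
      ring
    rw [h1, _root_.szegoKernel, inv_mul_cancel_left₀ (one_sub_conj_mul_ne_zero ha hw.le)]

end IsHardyMultiplier

end

/-! ### Model spaces of finite Blaschke products: kernel basis and dual functions. -/

noncomputable section

theorem inner_eq_integral (f g : LTwo) :
    inner ℂ f g = ∫ t, conj (f t) * g t ∂circleMeasure := by
  rw [L2.inner_def]
  simp only [RCLike.inner_apply, mul_comm]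

theorem inner_eq_integral_of_ae {f g : LTwo} {F G : UCircle → ℂ}
    (hf : f =ᵐ[circleMeasure] F) (hg : g =ᵐ[circleMeasure] G) :
    inner ℂ f g = ∫ t, conj (F t) * G t ∂circleMeasure := by
  rw [inner_eq_integral]
  refine integral_congr_ae ?_
  filter_upwards [hf, hg] with t h1 h2
  rw [h1, h2]

theorem mem_hardySpace_iff {f : LTwo} : f ∈ hardySpace ↔ IsHardy f := by
  have key : ∀ k : ℕ, fourierCoeff (f : UCircle → ℂ) (-((k : ℤ) + 1)) =
      ∫ t, (toCircle t : ℂ) ^ (k + 1) * f t ∂circleMeasure := by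
    intro k
    rw [fourierCoeff]
    congr 1 with t
    rw [neg_neg, fourier_apply, toCircle_zsmul, smul_eq_mul]
    norm_cast
  constructor
  · intro h
    exact ⟨Lp.memLp f, fun k => by rw [← key]; exact h _ (by omega)⟩
  · intro h k hk
    obtain ⟨j, rfl⟩ : ∃ j : ℕ, k = -((j : ℤ) + 1) := ⟨(-k - 1).toNat, by omega⟩
    rw [key, h.moment]

theorem mem_modelSpace_of_ae {α : ℂ → ℂ} {f : LTwo} {F : UCircle → ℂ}
    (hf : f =ᵐ[circleMeasure] F) (hF : IsHardy F)
    (h : ∀ g, IsHardy g → ∫ t, conj (onCircle α t * g t) * F t ∂circleMeasure = 0) :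
    f ∈ modelSpace α := by
  refine Submodule.mem_inf.2 ⟨mem_hardySpace_iff.2 (hF.congr hf.symm), ?_⟩
  rw [Submodule.mem_orthogonal]
  rintro u ⟨g, hg, hu⟩
  rw [inner_eq_integral_of_ae hu hf]
  exact h _ (mem_hardySpace_iff.1 hg)

/-- The class in `L²(∂𝔻)` of the Szegő kernel. -/
def szegoLp {w : ℂ} (hw : ‖w‖ < 1) : LTwo :=
  (memLp_of_continuous (continuous_szegoKernel hw) 2).toLp _

theorem coeFn_szegoLp {w : ℂ} (hw : ‖w‖ < 1) :
    szegoLp hw =ᵐ[circleMeasure] onCircle (szegoKernel w) :=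
  MemLp.coeFn_toLp _

/-- Pairing the kernel with `αg` evaluates `αg` at `w`, where `α` vanishes. -/
theorem szegoLp_mem_modelSpace {α : ℂ → ℂ} (hα : IsHardyMultiplier α) {w : ℂ} (hw : ‖w‖ < 1)
    (h0 : α w = 0) : szegoLp hw ∈ modelSpace α := by
  refine mem_modelSpace_of_ae (coeFn_szegoLp hw) (isHardy_szegoKernel hw) fun g hg => ?_
  have h := hα.eval g hg w hw
  rw [h0, zero_mul] at h
  rw [← map_zero (starRingEnd ℂ), ← h, ← integral_conj]
  congr 1 with t
  simp only [map_mul, Complex.conj_conj]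
  ring

section Blaschke

variable {m : ℕ} {a : Fin m → ℂ}

/-- The quotient of the Blaschke product by `a s - z`. -/
def blaschkeCofactor (a : Fin m → ℂ) (s : Fin m) (z : ℂ) : ℂ :=
  szegoKernel (a s) z * ∏ i ∈ Finset.univ.erase s, (a i - z) * szegoKernel (a i) z

theorem blaschke_eq_mul_cofactor (a : Fin m → ℂ) (s : Fin m) (z : ℂ) :
    blaschke a z = (a s - z) * blaschkeCofactor a s z := by
  rw [blaschke, blaschkeCofactor, ← mul_assoc, ← Finset.mul_prod_erase _ _ (Finset.mem_univ s)]
  rfl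

theorem blaschke_apply_zero (a : Fin m → ℂ) (s : Fin m) : blaschke a (a s) = 0 := by
  rw [blaschke_eq_mul_cofactor a s, sub_self, zero_mul]

theorem isHardyMultiplier_blaschkeFactor {w : ℂ} (hw : ‖w‖ < 1) :
    IsHardyMultiplier fun z => (w - z) * szegoKernel w z := by
  have h := (IsHardyMultiplier.const w).add
    ((IsHardyMultiplier.const (-1)).mul' IsHardyMultiplier.id)
  simp only [neg_one_mul, ← sub_eq_add_neg] at h
  exact h.mul' (IsHardyMultiplier.szegoKernel hw)

theorem isHardyMultiplier_blaschkeCofactor (ha : ∀ i, ‖a i‖ < 1) (s : Fin m) :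
    IsHardyMultiplier (blaschkeCofactor a s) :=
  (IsHardyMultiplier.szegoKernel (ha s)).mul'
    (IsHardyMultiplier.prod fun i _ => isHardyMultiplier_blaschkeFactor (ha i))

theorem isHardyMultiplier_blaschke (ha : ∀ i, ‖a i‖ < 1) : IsHardyMultiplier (blaschke a) :=
  IsHardyMultiplier.prod fun i _ => isHardyMultiplier_blaschkeFactor (ha i)

theorem differentiableAt_szegoKernel {w z : ℂ} (hw : ‖w‖ < 1) (hz : ‖z‖ < 1) :
    DifferentiableAt ℂ (szegoKernel w) z := by
  unfold szegoKernel
  exact (((differentiableAt_id).const_mul _).const_sub _).inv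
    (one_sub_conj_mul_ne_zero hw hz.le)

theorem deriv_blaschke (ha : ∀ i, ‖a i‖ < 1) (s : Fin m) :
    deriv (blaschke a) (a s) = -blaschkeCofactor a s (a s) := by
  have hd : DifferentiableAt ℂ (blaschkeCofactor a s) (a s) :=
    (differentiableAt_szegoKernel (ha s) (ha s)).mul
      (DifferentiableAt.fun_finsetProd fun i _ => (differentiableAt_id.const_sub _).mul
        (differentiableAt_szegoKernel (ha i) (ha s)))
  have h := ((hasDerivAt_id (a s)).const_sub (a s)).mul hd.hasDerivAt
  have he : blaschke a = (fun z => a s - id z) * blaschkeCofactor a s := by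
    ext z
    exact blaschke_eq_mul_cofactor a s z
  rw [he, h.deriv]
  simp

theorem deriv_blaschke_ne_zero (ha : ∀ i, ‖a i‖ < 1) (hinj : Function.Injective a) (s : Fin m) :
    deriv (blaschke a) (a s) ≠ 0 := by
  have hS : ∀ i, szegoKernel (a i) (a s) ≠ 0 := fun i =>
    inv_ne_zero (one_sub_conj_mul_ne_zero (ha i) (ha s).le)
  rw [deriv_blaschke ha, neg_ne_zero]
  refine mul_ne_zero (hS s) (Finset.prod_ne_zero_iff.2 fun i hi => mul_ne_zero ?_ (hS i))
  exact sub_ne_zero.2 (hinj.ne (Finset.ne_of_mem_erase hi))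

theorem blaschkeCofactor_apply_of_ne (hinj : Function.Injective a) {s q : Fin m} (h : q ≠ s) :
    blaschkeCofactor a s (a q) = 0 := by
  have h1 := blaschke_eq_mul_cofactor a s (a q)
  rw [blaschke_apply_zero, eq_comm, mul_eq_zero] at h1
  exact h1.resolve_left (sub_ne_zero.2 (hinj.ne h.symm))

theorem conj_blaschke_mul_self (ha : ∀ i, ‖a i‖ < 1) (t : UCircle) :
    conj (onCircle (blaschke a) t) * onCircle (blaschke a) t = 1 := by
  simp only [onCircle, blaschke, map_prod, ← Finset.prod_mul_distrib]
  refine Finset.prod_eq_one fun i _ => ?_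
  have h1 := toCircle_sub_ne_zero (ha i) t
  have h2 := one_sub_conj_mul_toCircle_ne_zero (ha i) t
  have h3 := toCircle_ne_zero t
  have h4 : 1 - a i * (toCircle t : ℂ)⁻¹ = ((toCircle t : ℂ) - a i) / toCircle t := by
    field_simp
  simp only [map_div₀, map_sub, map_mul, map_one, Complex.conj_conj, conj_toCircle, h4]
  field_simp
  ring

/-- The function `β / (z - b_s)` of `K_β`, dual to the Szegő kernel at the zero `b_s`. -/
def dualKernel (ha : ∀ i, ‖a i‖ < 1) (s : Fin m) : LTwo :=
  (memLp_of_continuous (isHardyMultiplier_blaschkeCofactor ha s).continuous_onCircle 2).neg.toLp _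

theorem coeFn_dualKernel (ha : ∀ i, ‖a i‖ < 1) (s : Fin m) :
    dualKernel ha s =ᵐ[circleMeasure] fun t => -onCircle (blaschkeCofactor a s) t :=
  MemLp.coeFn_toLp _

/-- On the circle the conjugate of `1/(z - w)` is `z/(1 - w̄z)`. This turns pairings with the dual
functions into integrals against Szegő kernels. -/
theorem conj_neg_blaschkeCofactor (ha : ∀ i, ‖a i‖ < 1) (s : Fin m) (t : UCircle) :
    conj (-onCircle (blaschkeCofactor a s) t) =
      conj (onCircle (blaschke a) t) * ((toCircle t : ℂ) * onCircle (szegoKernel (a s)) t) := by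
  have h1 := toCircle_sub_ne_zero (ha s) t
  have h2 := conj_szegoKernel (ha s) t
  have h3 : onCircle (blaschke a) t = (a s - toCircle t) * onCircle (blaschkeCofactor a s) t :=
    blaschke_eq_mul_cofactor a s _
  have h4 : -onCircle (blaschkeCofactor a s) t = onCircle (blaschke a) t *
      (conj (toCircle t : ℂ) * conj (onCircle (szegoKernel (a s)) t)) := by
    have := toCircle_ne_zero t
    rw [h2, h3, conj_toCircle]
    field_simp
    ring
  rw [h4, map_mul, map_mul, Complex.conj_conj, Complex.conj_conj]

theorem dualKernel_mem_modelSpace (ha : ∀ i, ‖a i‖ < 1) (s : Fin m) :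
    dualKernel ha s ∈ modelSpace (blaschke a) := by
  have hc := (isHardyMultiplier_blaschkeCofactor ha s).isHardy.const_mul (-1)
  simp only [neg_one_mul] at hc
  refine mem_modelSpace_of_ae (coeFn_dualKernel ha s) hc fun g hg => ?_
  rw [← map_zero (starRingEnd ℂ), ← (hg.szegoKernel_mul (ha s)).integral_toCircle_mul,
    ← integral_conj]
  congr 1 with t
  rw [← Complex.conj_conj (-onCircle (blaschkeCofactor a s) t), ← map_mul,
    conj_neg_blaschkeCofactor ha]
  congr 1
  linear_combination (g t * toCircle t * onCircle (szegoKernel (a s)) t) *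
    conj_blaschke_mul_self ha t

/-- The pairing evaluates the cofactor at `a q`: it vanishes at the other zeros, and at its own it
is minus the derivative of the product. -/
theorem inner_dualKernel_szegoLp (ha : ∀ i, ‖a i‖ < 1) (hinj : Function.Injective a)
    (s q : Fin m) :
    inner ℂ (dualKernel ha s) (szegoLp (ha q)) =
      if q = s then conj (deriv (blaschke a) (a s)) else 0 := by
  have h1 : inner ℂ (dualKernel ha s) (szegoLp (ha q)) = conj (-blaschkeCofactor a s (a q)) := by
    rw [inner_eq_integral_of_ae (coeFn_dualKernel ha s) (coeFn_szegoLp (ha q)),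
      ← (isHardyMultiplier_blaschkeCofactor ha s).integral_conj_szegoKernel_mul (ha q),
      ← integral_neg, ← integral_conj]
    congr 1 with t
    simp only [map_mul, map_neg, Complex.conj_conj]
    ring
  rw [h1]
  split_ifs with h
  · rw [h, deriv_blaschke ha]
  · rw [blaschkeCofactor_apply_of_ne hinj h, neg_zero, map_zero]

/-- Partial fractions. They reduce division by the whole Blaschke product to division by one factor
at a time, each handled by `IsHardy.div_sub`. -/
theorem exists_prod_inv_eq_sum [NeZero m] (hinj : Function.Injective a) :
    ∃ c : Fin m → ℂ, ∀ x : ℂ, (∀ i, x ≠ a i) →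
      ∏ i, (a i - x)⁻¹ = ∑ i, c i * (a i - x)⁻¹ := by
  classical
  -- Barycentric formula for the interpolant of the constant `1`; the signs come from passing from
  -- `x - a i` to `a i - x`, in the product and in each summand.
  refine ⟨fun i => -(-1) ^ m * Lagrange.nodalWeight Finset.univ a i, fun x hx => ?_⟩
  have h := Lagrange.eval_interpolate_not_at_node (s := Finset.univ) (v := a) 1 (x := x)
    fun i _ => hx i
  rw [Lagrange.interpolate_one hinj.injOn Finset.univ_nonempty, Polynomial.eval_one,
    Lagrange.eval_nodal] at h
  have h0 : ∏ i, (x - a i) ≠ 0 := Finset.prod_ne_zero_iff.2 fun i _ => sub_ne_zero.2 (hx i)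
  have hl : ∏ i, (a i - x)⁻¹ = (-1) ^ m * (∏ i, (x - a i))⁻¹ := by
    have : ∀ i, (a i - x)⁻¹ = (-1) * (x - a i)⁻¹ := fun i => by
      rw [← neg_sub, inv_neg, neg_one_mul]
    simp only [this, Finset.prod_mul_distrib, Finset.prod_inv_distrib, Finset.prod_const,
      Finset.card_univ, Fintype.card_fin]
  rw [hl, inv_eq_of_mul_eq_one_right h.symm, Finset.mul_sum]
  refine Finset.sum_congr rfl fun i _ => ?_
  rw [← neg_sub x, inv_neg, Pi.one_apply]
  ring

/-- An element of `H²` that vanishes at the zeros of a Blaschke product is divisible by it. -/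
theorem mem_mulHardySpace_of_inner_eq_zero [NeZero m] (ha : ∀ i, ‖a i‖ < 1)
    (hinj : Function.Injective a) {f : LTwo} (hf : f ∈ hardySpace)
    (h0 : ∀ i, inner ℂ (szegoLp (ha i)) f = (0 : ℂ)) : f ∈ mulHardySpace (blaschke a) := by
  obtain ⟨c, hc⟩ := exists_prod_inv_eq_sum hinj
  rw [mem_hardySpace_iff] at hf
  have hq : ∀ i, IsHardy fun t => c i * ((a i - toCircle t)⁻¹ * f t) := by
    intro i
    refine (hf.div_sub (ha i) ?_).const_mul (c i)
    rw [← h0 i, inner_eq_integral_of_ae (coeFn_szegoLp (ha i)) Filter.EventuallyEq.rfl]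
  -- The denominators of the product: this polynomial times the partial-fraction sum is the quotient
  -- of `f` by the Blaschke product.
  have hM : IsHardyMultiplier fun z => ∏ i, (1 + -conj (a i) * z) :=
    IsHardyMultiplier.prod fun i _ => (IsHardyMultiplier.const 1).add
      ((IsHardyMultiplier.const _).mul' IsHardyMultiplier.id)
  have hG := hM.mul _ (IsHardy.sum (s := Finset.univ) fun i _ => hq i)
  refine ⟨hG.memLp.toLp _, mem_hardySpace_iff.2 (hG.congr (MemLp.coeFn_toLp _).symm), ?_⟩
  filter_upwards [MemLp.coeFn_toLp hG.memLp] with t ht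
  have hne : ∀ i, (toCircle t : ℂ) ≠ a i := fun i => sub_ne_zero.1 (toCircle_sub_ne_zero (ha i) t)
  have hsum : ∑ i, c i * ((a i - toCircle t)⁻¹ * f t) = (∏ i, (a i - (toCircle t : ℂ))⁻¹) * f t := by
    rw [hc _ hne, Finset.sum_mul]
    simp only [mul_assoc]
  rw [ht, hsum]
  have h1 : onCircle (blaschke a) t * (onCircle (fun z => ∏ i, (1 + -conj (a i) * z)) t *
      ∏ i, (a i - (toCircle t : ℂ))⁻¹) = 1 := by
    simp only [onCircle, blaschke, ← Finset.prod_mul_distrib]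
    refine Finset.prod_eq_one fun i _ => ?_
    have h2 := one_sub_conj_mul_toCircle_ne_zero (ha i) t
    have h3 : a i - (toCircle t : ℂ) ≠ 0 := sub_ne_zero.2 (hne i).symm
    rw [neg_mul, ← sub_eq_add_neg, mul_comm (1 - _), ← mul_assoc, div_mul_eq_mul_div,
      mul_inv_cancel₀ h3, one_div, inv_mul_cancel₀ h2]
  linear_combination (-f t) * h1

/-- The Szegő kernel at a zero of the Blaschke product, as an element of the model space. -/
def szegoModel (ha : ∀ i, ‖a i‖ < 1) (i : Fin m) : modelSpace (blaschke a) :=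
  ⟨szegoLp (ha i), szegoLp_mem_modelSpace (isHardyMultiplier_blaschke ha) (ha i)
    (blaschke_apply_zero a i)⟩

theorem inner_dualKernel_sum_szegoModel (ha : ∀ i, ‖a i‖ < 1) (hinj : Function.Injective a)
    (c : Fin m → ℂ) (s : Fin m) :
    inner ℂ (dualKernel ha s) ((∑ i, c i • szegoModel ha i : modelSpace (blaschke a)) : LTwo) =
      conj (deriv (blaschke a) (a s)) * c s := by
  simp [szegoModel, inner_sum, inner_smul_right, inner_dualKernel_szegoLp ha hinj, mul_comm]

theorem linearIndependent_szegoModel (ha : ∀ i, ‖a i‖ < 1) (hinj : Function.Injective a) :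
    LinearIndependent ℂ (szegoModel ha) := by
  rw [Fintype.linearIndependent_iff]
  intro c hc s
  have h := inner_dualKernel_sum_szegoModel ha hinj c s
  rw [hc, Submodule.coe_zero, inner_zero_right, eq_comm, mul_eq_zero] at h
  exact h.resolve_left ((map_ne_zero _).2 (deriv_blaschke_ne_zero ha hinj s))

/-- A vector of the model space orthogonal to all these kernels vanishes at every zero, hence lies
in `αH²` and is orthogonal to itself. -/
theorem span_szegoModel [NeZero m] (ha : ∀ i, ‖a i‖ < 1) (hinj : Function.Injective a) :
    Submodule.span ℂ (Set.range (szegoModel ha)) = ⊤ := by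
  have : FiniteDimensional ℂ (Submodule.span ℂ (Set.range (szegoModel ha))) :=
    FiniteDimensional.span_of_finite ℂ (Set.finite_range _)
  rw [← Submodule.orthogonal_eq_bot_iff, Submodule.eq_bot_iff]
  intro f hf
  rw [Submodule.mem_orthogonal] at hf
  have h1 : (f : LTwo) ∈ mulHardySpace (blaschke a) :=
    mem_mulHardySpace_of_inner_eq_zero ha hinj (Submodule.mem_inf.1 f.2).1 fun i =>
      hf _ (Submodule.subset_span (Set.mem_range_self i))
  have h2 := (Submodule.mem_orthogonal _ _).1 (Submodule.mem_inf.1 f.2).2 _ h1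
  exact Subtype.ext (inner_self_eq_zero.1 h2)

/-- The basis of the model space made of the kernels at the zeros of the Blaschke product. -/
def szegoBasis [NeZero m] (ha : ∀ i, ‖a i‖ < 1) (hinj : Function.Injective a) :
    Module.Basis (Fin m) ℂ (modelSpace (blaschke a)) :=
  Module.Basis.mk (linearIndependent_szegoModel ha hinj) (span_szegoModel ha hinj).ge

theorem szegoBasis_apply [NeZero m] (ha : ∀ i, ‖a i‖ < 1) (hinj : Function.Injective a)
    (i : Fin m) : szegoBasis ha hinj i = szegoModel ha i := by
  rw [szegoBasis, Module.Basis.mk_apply]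

theorem coeFn_szegoBasis [NeZero m] (ha : ∀ i, ‖a i‖ < 1) (hinj : Function.Injective a)
    (i : Fin m) : ((szegoBasis ha hinj i : LTwo) : UCircle → ℂ) =ᵐ[circleMeasure]
      onCircle (szegoKernel (a i)) := by
  rw [szegoBasis_apply]
  exact coeFn_szegoLp (ha i)

theorem modelKernel_blaschke_apply_zero (a : Fin m → ℂ) (i : Fin m) :
    modelKernel (blaschke a) (a i) = szegoKernel (a i) := by
  ext z
  rw [modelKernel, szegoKernel, blaschke_apply_zero, map_zero, zero_mul, sub_zero, one_div]

theorem inner_dualKernel_eq_repr [NeZero m] (ha : ∀ i, ‖a i‖ < 1) (hinj : Function.Injective a)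
    (x : modelSpace (blaschke a)) (s : Fin m) :
    inner ℂ (dualKernel ha s) (x : LTwo) =
      conj (deriv (blaschke a) (a s)) * (szegoBasis ha hinj).repr x s := by
  conv_lhs => rw [← (szegoBasis ha hinj).sum_repr x]
  simp only [szegoBasis_apply]
  exact inner_dualKernel_sum_szegoModel ha hinj _ s

end Blaschke

end

/-! ### Symbols, Hermite interpolation and the difference form of the matrix. -/

noncomputable section

/-- The nodal polynomial `N` has simple zeros, so adding `N * M` to the Lagrange interpolant keeps
the values and corrects the derivatives by `N' M`. -/
theorem exists_polynomial_eval_and_derivative (S : Finset ℂ) (F G : ℂ → ℂ) :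
    ∃ q : Polynomial ℂ, ∀ x ∈ S, q.eval x = F x ∧ q.derivative.eval x = G x := by
  classical
  set L := Lagrange.interpolate S id F with hL
  set N := Lagrange.nodal S (id : ℂ → ℂ) with hN
  set M := Lagrange.interpolate S id
    (fun x => (G x - L.derivative.eval x) * (N.derivative.eval x)⁻¹) with hM
  refine ⟨L + N * M, fun x hx => ?_⟩
  have h1 : L.eval x = F x := Lagrange.eval_interpolate_at_node F (Set.injOn_id _) hx
  have h2 : N.eval x = 0 := Lagrange.eval_nodal_at_node (v := id) hx
  have h3 : M.eval x = (G x - L.derivative.eval x) * (N.derivative.eval x)⁻¹ :=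
    Lagrange.eval_interpolate_at_node _ (Set.injOn_id _) hx
  have h4 : N.derivative.eval x ≠ 0 := by
    have h := Lagrange.nodalWeight_ne_zero (Set.injOn_id (S : Set ℂ)) hx
    rw [Lagrange.nodalWeight_eq_eval_derivative_nodal hx] at h
    exact fun h0 => h (inv_eq_zero.2 h0)
  constructor
  · simp [h1, h2]
  · simp only [Polynomial.derivative_add, Polynomial.derivative_mul, Polynomial.eval_add,
      Polynomial.eval_mul, h2, h3]
    field_simp
    ring

theorem toCircle_mul_szegoKernel_mul {x y : ℂ} (hx : ‖x‖ < 1) (hy : ‖y‖ < 1) (t : UCircle) :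
    (conj x - conj y) *
        ((toCircle t : ℂ) * onCircle (szegoKernel y) t * onCircle (szegoKernel x) t) =
      onCircle (szegoKernel x) t - onCircle (szegoKernel y) t := by
  have h1 := one_sub_conj_mul_toCircle_ne_zero hx t
  have h2 := one_sub_conj_mul_toCircle_ne_zero hy t
  simp only [onCircle, szegoKernel]
  field_simp
  ring

theorem conj_sub_mul_integral_mul_szegoKernel_mul {x y : ℂ} (hx : ‖x‖ < 1) (hy : ‖y‖ < 1)
    {ψ : UCircle → ℂ} (hψ : MemLp ψ 2 circleMeasure) :
    (conj x - conj y) * ∫ t, ψ t *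
        ((toCircle t : ℂ) * onCircle (szegoKernel y) t * onCircle (szegoKernel x) t)
        ∂circleMeasure =
      (∫ t, onCircle (szegoKernel x) t * ψ t ∂circleMeasure) -
        ∫ t, onCircle (szegoKernel y) t * ψ t ∂circleMeasure := by
  rw [← integral_const_mul, ← integral_sub
    (integrable_continuous_mul (continuous_szegoKernel hx) hψ)
    (integrable_continuous_mul (continuous_szegoKernel hy) hψ)]
  congr 1 with t
  linear_combination ψ t * toCircle_mul_szegoKernel_mul hx hy t

theorem integral_szegoKernel_mul_conj_polynomial {w : ℂ} (hw : ‖w‖ < 1) (q : Polynomial ℂ) :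
    ∫ t, onCircle (szegoKernel w) t * conj (onCircle (fun z => q.eval z) t) ∂circleMeasure =
      conj (q.eval w) := by
  rw [← (IsHardyMultiplier.polynomial q).integral_conj_szegoKernel_mul hw, ← integral_conj]
  simp only [map_mul, Complex.conj_conj]

/-- Write `q = q(w) + (z - w) p`. The constant contributes the mean of `z S_w²`, which is zero; on
the circle `conj(z - w) z S_w = 1`, so the rest is the conjugate of `p(w) = q'(w)`. -/
theorem integral_conj_polynomial_mul_szegoKernel_sq {w : ℂ} (hw : ‖w‖ < 1) (q : Polynomial ℂ) :
    ∫ t, conj (onCircle (fun z => q.eval z) t) *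
        ((toCircle t : ℂ) * onCircle (szegoKernel w) t * onCircle (szegoKernel w) t)
        ∂circleMeasure = conj (q.derivative.eval w) := by
  obtain ⟨p, hp⟩ := Polynomial.X_sub_C_dvd_sub_C_eval (a := w) (p := q)
  have hq : q = Polynomial.C (q.eval w) + (Polynomial.X - Polynomial.C w) * p := by
    rw [← hp]
    ring
  have hd : q.derivative.eval w = p.eval w := by
    rw [hq]
    simp
  have hS := isHardy_szegoKernel hw
  have hpc : Continuous fun t => conj (onCircle (fun z => p.eval z) t) :=
    Complex.continuous_conj.comp (IsHardyMultiplier.polynomial p).continuous_onCircle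
  rw [hd, ← integral_szegoKernel_mul_conj_polynomial hw p, ← sub_eq_zero]
  have hi : Integrable (fun t => conj (onCircle (fun z => q.eval z) t) *
      ((toCircle t : ℂ) * onCircle (szegoKernel w) t * onCircle (szegoKernel w) t))
      circleMeasure := by
    have h := integrable_continuous_mul (Complex.continuous_conj.comp
      (IsHardyMultiplier.polynomial q).continuous_onCircle) (hS.szegoKernel_mul hw).toCircle_mul.memLp
    simpa only [mul_assoc, Function.comp_apply] using h
  have hi2 : Integrable (fun t => onCircle (szegoKernel w) t *
      conj (onCircle (fun z => p.eval z) t)) circleMeasure :=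
    integrable_continuous_mul (continuous_szegoKernel hw) (memLp_of_continuous hpc 2)
  rw [← integral_sub hi hi2, ← mul_zero (conj (q.eval w)),
    ← (hS.szegoKernel_mul hw).integral_toCircle_mul, ← integral_const_mul]
  congr 1 with t
  have h1 : onCircle (fun z => q.eval z) t =
      q.eval w + ((toCircle t : ℂ) - w) * onCircle (fun z => p.eval z) t := by
    simp only [onCircle]
    conv_lhs => rw [hq]
    simp
  have h2 := one_sub_conj_mul_toCircle_ne_zero hw t
  have h3 := toCircle_ne_zero t
  rw [h1, map_add, map_mul, map_sub, conj_toCircle]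
  simp only [onCircle, szegoKernel]
  field_simp
  ring

theorem conj_sub_conj_ne_zero {x y : ℂ} (h : x ≠ y) : conj x - conj y ≠ 0 := by
  rw [← map_sub]
  exact (map_ne_zero _).2 (sub_ne_zero.2 h)

section Symbol

variable {m n : ℕ} [NeZero m] {a : Fin m → ℂ} {b : Fin n → ℂ}

theorem memLp_top_of_mem_modelSpace (ha : ∀ i, ‖a i‖ < 1) (hinj : Function.Injective a)
    (f : modelSpace (blaschke a)) : MemLp ((f : LTwo) : UCircle → ℂ) ∞ circleMeasure := by
  have hf : f ∈ Submodule.span ℂ (Set.range (szegoModel ha)) := by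
    rw [span_szegoModel ha hinj]
    trivial
  induction hf using Submodule.span_induction with
  | mem x hx =>
    obtain ⟨i, rfl⟩ := hx
    exact (memLp_of_continuous (continuous_szegoKernel (ha i)) ∞).ae_eq
      (coeFn_szegoLp (ha i)).symm
  | zero => exact MemLp.zero.ae_eq (Lp.coeFn_zero ℂ 2 circleMeasure).symm
  | add x y _ _ hx hy => exact (hx.add hy).ae_eq (Lp.coeFn_add _ _).symm
  | smul c x _ hx => exact (hx.const_smul c).ae_eq (Lp.coeFn_smul _ _).symm

theorem coeFn_mulBounded (φ f : LTwo) (hf : MemLp (f : UCircle → ℂ) ∞ circleMeasure) :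
    mulBounded φ f hf =ᵐ[circleMeasure] fun t => φ t * f t :=
  MemLp.coeFn_toLp _

/-- Multiplication by a symbol in `L²(∂𝔻)`, on a model space of bounded functions. -/
def mulModel {α : ℂ → ℂ} (φ : LTwo)
    (hbdd : ∀ f : modelSpace α, MemLp ((f : LTwo) : UCircle → ℂ) ∞ circleMeasure) :
    modelSpace α →ₗ[ℂ] LTwo where
  toFun f := mulBounded φ f (hbdd f)
  map_add' f g := by
    refine Lp.ext ?_
    filter_upwards [coeFn_mulBounded φ _ (hbdd (f + g)), coeFn_mulBounded φ _ (hbdd f),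
      coeFn_mulBounded φ _ (hbdd g), Lp.coeFn_add (f : LTwo) g,
      Lp.coeFn_add (mulBounded φ f (hbdd f)) (mulBounded φ g (hbdd g))] with t h1 h2 h3 h4 h5
    rw [h1, h5, Pi.add_apply, h2, h3, Submodule.coe_add, h4, Pi.add_apply, mul_add]
  map_smul' c f := by
    refine Lp.ext ?_
    filter_upwards [coeFn_mulBounded φ _ (hbdd (c • f)), coeFn_mulBounded φ _ (hbdd f),
      Lp.coeFn_smul c (f : LTwo), Lp.coeFn_smul c (mulBounded φ f (hbdd f))] with t h1 h2 h3 h4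
    rw [h1, RingHom.id_apply, h4, Pi.smul_apply, h2, Submodule.coe_smul, h3, Pi.smul_apply,
      smul_eq_mul, smul_eq_mul, mul_left_comm]

theorem mem_asymTruncToeplitz_iff_forall_basis {α : ℂ → ℂ} {ι : Type*} [Finite ι]
    (u : Module.Basis ι ℂ (modelSpace α))
    (hbdd : ∀ f : modelSpace α, MemLp ((f : LTwo) : UCircle → ℂ) ∞ circleMeasure) {β : ℂ → ℂ}
    (A : modelSpace α →ₗ[ℂ] modelSpace β) :
    A ∈ asymTruncToeplitz α β ↔ ∃ φ : LTwo, ∀ i,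
      A (u i) = (modelSpace β).orthogonalProjectionOnto (mulBounded φ (u i) (hbdd (u i))) := by
  have : FiniteDimensional ℂ (modelSpace α) := u.finiteDimensional_of_finite
  constructor
  · rintro ⟨-, φ, h⟩
    exact ⟨φ, fun i => h (u i) (hbdd (u i))⟩
  · rintro ⟨φ, h⟩
    refine ⟨A.continuous_of_finiteDimensional, φ, fun f hf => ?_⟩
    have hA : A = (modelSpace β).orthogonalProjectionOnto.toLinearMap ∘ₗ mulModel φ hbdd :=
      u.ext h
    exact LinearMap.congr_fun hA f

theorem integral_conj_blaschke_mul_eq_inner (ha : ∀ i, ‖a i‖ < 1) (hb : ∀ j, ‖b j‖ < 1)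
    (hainj : Function.Injective a) (φ : LTwo) (p : Fin m) (s : Fin n) :
    inner ℂ (dualKernel hb s) (mulBounded φ (szegoBasis ha hainj p)
        (memLp_top_of_mem_modelSpace ha hainj _)) =
      ∫ t, (conj (onCircle (blaschke b) t) * φ t) *
        ((toCircle t : ℂ) * onCircle (szegoKernel (b s)) t * onCircle (szegoKernel (a p)) t)
        ∂circleMeasure := by
  rw [inner_eq_integral_of_ae (coeFn_dualKernel hb s) (coeFn_mulBounded _ _ _)]
  refine integral_congr_ae ?_
  filter_upwards [coeFn_szegoBasis ha hainj p] with t ht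
  rw [conj_neg_blaschkeCofactor hb, ht]
  ring

theorem modelSpace_ext (ha : ∀ i, ‖a i‖ < 1) (hinj : Function.Injective a)
    {x y : modelSpace (blaschke a)}
    (h : ∀ s, (inner ℂ (dualKernel ha s) (x : LTwo) : ℂ) = inner ℂ (dualKernel ha s) (y : LTwo)) :
    x = y := by
  refine (szegoBasis ha hinj).ext_elem fun s => ?_
  have hs := h s
  rw [inner_dualKernel_eq_repr ha hinj, inner_dualKernel_eq_repr ha hinj] at hs
  exact mul_left_cancel₀ ((map_ne_zero _).2 (deriv_blaschke_ne_zero ha hinj s)) hs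

/-- The substitution is `ψ = β̄φ`, inverted by `φ = βψ`. The projection disappears because the dual
functions already lie in `K_β`. -/
theorem mem_asymTruncToeplitz_iff_exists_symbol [NeZero n]
    (ha : ∀ i, ‖a i‖ < 1) (hb : ∀ j, ‖b j‖ < 1)
    (hainj : Function.Injective a) (hbinj : Function.Injective b)
    (A : modelSpace (blaschke a) →ₗ[ℂ] modelSpace (blaschke b)) :
    A ∈ asymTruncToeplitz (blaschke a) (blaschke b) ↔
      ∃ ψ : UCircle → ℂ, MemLp ψ 2 circleMeasure ∧ ∀ p s,
        conj (deriv (blaschke b) (b s)) *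
            LinearMap.toMatrix (szegoBasis ha hainj) (szegoBasis hb hbinj) A s p =
          ∫ t, ψ t * ((toCircle t : ℂ) * onCircle (szegoKernel (b s)) t *
            onCircle (szegoKernel (a p)) t) ∂circleMeasure := by
  have hβ := (isHardyMultiplier_blaschke hb).continuous_onCircle
  rw [mem_asymTruncToeplitz_iff_forall_basis (szegoBasis ha hainj)
    (memLp_top_of_mem_modelSpace ha hainj)]
  constructor
  · rintro ⟨φ, h⟩
    refine ⟨fun t => conj (onCircle (blaschke b) t) * φ t,
      memLp_continuous_mul (Complex.continuous_conj.comp hβ) (Lp.memLp φ), fun p s => ?_⟩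
    rw [LinearMap.toMatrix_apply, ← inner_dualKernel_eq_repr, h p,
      ← integral_conj_blaschke_mul_eq_inner ha hb hainj]
    exact Submodule.inner_orthogonalProjectionOnto_eq_of_mem_left
      ⟨dualKernel hb s, dualKernel_mem_modelSpace hb s⟩ _
  · rintro ⟨ψ, hψ, h⟩
    have hψ2 := memLp_continuous_mul hβ hψ
    refine ⟨hψ2.toLp _, fun p => modelSpace_ext hb hbinj fun s => ?_⟩
    rw [inner_dualKernel_eq_repr hb hbinj, ← LinearMap.toMatrix_apply, h p s]
    refine Eq.trans ?_ (Submodule.inner_orthogonalProjectionOnto_eq_of_mem_left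
      (⟨dualKernel hb s, dualKernel_mem_modelSpace hb s⟩ : modelSpace (blaschke b)) _).symm
    refine Eq.trans ?_ (integral_conj_blaschke_mul_eq_inner ha hb hainj _ p s).symm
    refine integral_congr_ae ?_
    filter_upwards [MemLp.coeFn_toLp hψ2] with t ht
    rw [ht, ← mul_assoc (conj _), conj_blaschke_mul_self hb, one_mul]

/-- Asymmetric truncated Toeplitz operators between the model spaces of two finite Blaschke
products with simple zeros are those whose weighted matrix entries are of difference form. -/
theorem mem_asymTruncToeplitz_iff_exists_difference [NeZero n]
    (ha : ∀ i, ‖a i‖ < 1) (hb : ∀ j, ‖b j‖ < 1)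
    (hainj : Function.Injective a) (hbinj : Function.Injective b)
    (A : modelSpace (blaschke a) →ₗ[ℂ] modelSpace (blaschke b)) :
    A ∈ asymTruncToeplitz (blaschke a) (blaschke b) ↔
      ∃ F : ℂ → ℂ, ∀ p s, conj (deriv (blaschke b) (b s)) * (conj (a p) - conj (b s)) *
          LinearMap.toMatrix (szegoBasis ha hainj) (szegoBasis hb hbinj) A s p =
        F (a p) - F (b s) := by
  classical
  rw [mem_asymTruncToeplitz_iff_exists_symbol ha hb hainj hbinj]
  set r := LinearMap.toMatrix (szegoBasis ha hainj) (szegoBasis hb hbinj) A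
  constructor
  · rintro ⟨ψ, hψ, h⟩
    refine ⟨fun w => ∫ t, onCircle (szegoKernel w) t * ψ t ∂circleMeasure, fun p s => ?_⟩
    rw [← conj_sub_mul_integral_mul_szegoKernel_mul (ha p) (hb s) hψ, ← h p s]
    ring
  · rintro ⟨F, hF⟩
    -- At a common zero the difference condition reads `0 = 0`, so the entry there is arbitrary and
    -- is realised by the derivative of `q`. Injectivity makes the prescription consistent.
    have hG : ∃ G : ℂ → ℂ, ∀ p s, a p = b s →
        G (b s) = conj (conj (deriv (blaschke b) (b s)) * r s p) := by
      have hex : ∀ x, ∃ y, ∀ p s, a p = x → b s = x →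
          y = conj (conj (deriv (blaschke b) x) * r s p) := by
        intro x
        by_cases hx : ∃ p s, a p = x ∧ b s = x
        · obtain ⟨p, s, hp, hs⟩ := hx
          refine ⟨conj (conj (deriv (blaschke b) x) * r s p), fun p' s' hp' hs' => ?_⟩
          rw [hainj (hp.trans hp'.symm), hbinj (hs.trans hs'.symm)]
        · exact ⟨0, fun p s hp hs => absurd ⟨p, s, hp, hs⟩ hx⟩
      choose G hG using hex
      exact ⟨G, fun p s hps => hG (b s) p s hps rfl⟩
    obtain ⟨G, hG⟩ := hG
    obtain ⟨q, hq⟩ := exists_polynomial_eval_and_derivative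
      (Finset.univ.image a ∪ Finset.univ.image b) (fun x => conj (F x)) G
    have hqa : ∀ p, conj (q.eval (a p)) = F (a p) := fun p => by
      rw [(hq (a p) (by simp)).1, Complex.conj_conj]
    have hqb : ∀ s, conj (q.eval (b s)) = F (b s) := fun s => by
      rw [(hq (b s) (by simp)).1, Complex.conj_conj]
    have hψ : MemLp (fun t => conj (onCircle (fun z => q.eval z) t)) 2 circleMeasure :=
      memLp_of_continuous (Complex.continuous_conj.comp
        (IsHardyMultiplier.polynomial q).continuous_onCircle) 2
    refine ⟨_, hψ, fun p s => ?_⟩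
    by_cases hps : a p = b s
    · rw [hps, integral_conj_polynomial_mul_szegoKernel_sq (hb s), (hq (b s) (by simp)).2,
        hG p s hps, Complex.conj_conj]
    · have hne : conj (a p) - conj (b s) ≠ 0 := by
        rw [← map_sub]
        exact (map_ne_zero _).2 (sub_ne_zero.2 hps)
      refine mul_left_cancel₀ hne ?_
      rw [conj_sub_mul_integral_mul_szegoKernel_mul (ha p) (hb s) hψ,
        integral_szegoKernel_mul_conj_polynomial (ha p),
        integral_szegoKernel_mul_conj_polynomial (hb s), hqa, hqb, ← hF p s]
      ring

end Symbol

end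

/-! ### Algebra: from the difference form to the entry formulas. -/

theorem exists_extension_of_compatible {ι κ : Type*} {a : ι → ℂ} {b : κ → ℂ}
    (hainj : Function.Injective a) (hbinj : Function.Injective b) (f : ι → ℂ) (g : κ → ℂ)
    (h : ∀ p s, a p = b s → f p = g s) :
    ∃ F : ℂ → ℂ, (∀ p, F (a p) = f p) ∧ ∀ s, F (b s) = g s := by
  have hex : ∀ x, ∃ y, (∀ p, a p = x → y = f p) ∧ ∀ s, b s = x → y = g s := by
    intro x
    by_cases hx : ∃ p, a p = x
    · obtain ⟨p, rfl⟩ := hx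
      exact ⟨f p, fun q hq => by rw [hainj hq], fun s hs => h p s hs.symm⟩
    by_cases hy : ∃ s, b s = x
    · obtain ⟨s, rfl⟩ := hy
      exact ⟨g s, fun q hq => absurd ⟨q, hq⟩ hx, fun q hq => by rw [hbinj hq]⟩
    · exact ⟨0, fun q hq => absurd ⟨q, hq⟩ hx, fun q hq => absurd ⟨q, hq⟩ hy⟩
  choose F hF using hex
  exact ⟨F, fun p => (hF _).1 p rfl, fun s => (hF _).2 s rfl⟩

theorem eq_castLE_of_apply_eq {m n l : ℕ} {a : Fin m → ℂ} {b : Fin n → ℂ} {hlm : l ≤ m}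
    {hln : l ≤ n} (hbinj : Function.Injective b)
    (hcommon : ∀ i : Fin l, a (Fin.castLE hlm i) = b (Fin.castLE hln i))
    (honly : ∀ (p : Fin m) (s : Fin n), a p = b s → (p : ℕ) < l) {p : Fin m} {s : Fin n}
    (hps : a p = b s) : ∃ i : Fin l, p = Fin.castLE hlm i ∧ s = Fin.castLE hln i := by
  have hp := honly p s hps
  exact ⟨⟨p, hp⟩, rfl, hbinj (hps.symm.trans (hcommon ⟨p, hp⟩))⟩

section DifferenceForm

variable {m n : ℕ} [NeZero m] [NeZero n] {a : Fin m → ℂ} {b : Fin n → ℂ} {c : Fin n → ℂ}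

theorem exists_difference_iff_of_disjoint (hainj : Function.Injective a)
    (hbinj : Function.Injective b) (hc : ∀ s, c s ≠ 0) (hab : ∀ p s, a p ≠ b s)
    (r : Matrix (Fin n) (Fin m) ℂ) :
    (∃ F : ℂ → ℂ, ∀ p s, c s * (conj (a p) - conj (b s)) * r s p = F (a p) - F (b s)) ↔
      ∀ (p : Fin m) (s : Fin n), r s p =
        (c s * (conj (a 0) - conj (b s)) * r s 0 + c 0 * (conj (b 0) - conj (a 0)) * r 0 0
          + c 0 * (conj (a p) - conj (b 0)) * r 0 p) / (c s * (conj (a p) - conj (b s))) := by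
  have hne : ∀ p s, c s * (conj (a p) - conj (b s)) ≠ 0 := fun p s =>
    mul_ne_zero (hc s) (conj_sub_conj_ne_zero (hab p s))
  constructor
  · rintro ⟨F, hF⟩ p s
    rw [eq_div_iff (hne p s)]
    -- With `D(p,s) = F(a_p) - F(b_s)`, this is `D(p,s) = D(0,s) - D(0,0) + D(p,0)`.
    linear_combination hF p s - hF 0 s + hF 0 0 - hF p 0
  · intro h
    -- `F` matters only up to a constant; the choice is `F (b 0) = 0`, which reads the other values
    -- off the first row and column.
    obtain ⟨F, hFa, hFb⟩ := exists_extension_of_compatible hainj hbinj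
      (fun p => c 0 * (conj (a p) - conj (b 0)) * r 0 p)
      (fun s => c 0 * (conj (a 0) - conj (b 0)) * r 0 0 - c s * (conj (a 0) - conj (b s)) * r s 0)
      fun p s hps => absurd hps (hab p s)
    refine ⟨F, fun p s => ?_⟩
    have hps := (eq_div_iff (hne p s)).1 (h p s)
    rw [hFa, hFb]
    linear_combination hps

variable {l : ℕ} {hlm : l ≤ m} {hln : l ≤ n}

theorem exists_difference_iff_of_common (hainj : Function.Injective a)
    (hbinj : Function.Injective b) (hc : ∀ s, c s ≠ 0) (hl : 0 < l)
    (hcommon : ∀ i : Fin l, a (Fin.castLE hlm i) = b (Fin.castLE hln i))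
    (honly : ∀ (p : Fin m) (s : Fin n), a p = b s → (p : ℕ) < l)
    (r : Matrix (Fin n) (Fin m) ℂ) :
    (∃ F : ℂ → ℂ, ∀ p s, c s * (conj (a p) - conj (b s)) * r s p = F (a p) - F (b s)) ↔
      (∀ (p : Fin m) (s : Fin l), (s : ℕ) ≠ (p : ℕ) → r (Fin.castLE hln s) p =
        (c 0 * (conj (a 0) - conj (b (Fin.castLE hln s))) * r 0 (Fin.castLE hlm s)
          + c 0 * (conj (a p) - conj (b 0)) * r 0 p)
          / (c (Fin.castLE hln s) * (conj (a p) - conj (b (Fin.castLE hln s))))) ∧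
      ∀ (p : Fin m) (s : Fin n), l ≤ (s : ℕ) → r s p =
        (c s * (conj (a 0) - conj (b s)) * r s 0 + c 0 * (conj (a p) - conj (b 0)) * r 0 p)
          / (c s * (conj (a p) - conj (b s))) := by
  have h00 : a 0 = b 0 := by
    have h := hcommon ⟨0, hl⟩
    rwa [show Fin.castLE hlm ⟨0, hl⟩ = 0 from Fin.ext (by simp),
      show Fin.castLE hln ⟨0, hl⟩ = 0 from Fin.ext (by simp)] at h
  have hne : ∀ (p : Fin m) (s : Fin l), (s : ℕ) ≠ (p : ℕ) →
      c (Fin.castLE hln s) * (conj (a p) - conj (b (Fin.castLE hln s))) ≠ 0 := by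
    intro p s hsp
    refine mul_ne_zero (hc _) (conj_sub_conj_ne_zero fun h => hsp ?_)
    rw [← hcommon s] at h
    rw [hainj h, Fin.val_castLE]
  have hne' : ∀ (p : Fin m) (s : Fin n), l ≤ (s : ℕ) →
      c s * (conj (a p) - conj (b s)) ≠ 0 := by
    intro p s hs
    refine mul_ne_zero (hc _) (conj_sub_conj_ne_zero fun h => ?_)
    obtain ⟨i, -, rfl⟩ := eq_castLE_of_apply_eq hbinj hcommon honly h
    exact absurd i.2 (not_lt.2 hs)
  constructor
  · rintro ⟨F, hF⟩
    constructor
    · intro p s hsp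
      have h1 := hF (Fin.castLE hlm s) 0
      rw [eq_div_iff (hne p s hsp)]
      rw [hcommon s, ← h00] at h1
      have h2 := hF p (Fin.castLE hln s)
      have h3 := hF p 0
      rw [← h00] at h3 ⊢
      linear_combination h2 - h3 + h1
    · intro p s hs
      rw [eq_div_iff (hne' p s hs)]
      have h3 := hF p 0
      rw [← h00] at h3 ⊢
      linear_combination hF p s - h3 - hF 0 s
  · rintro ⟨h1, h2⟩
    -- Normalised by `F (b 0) = 0`, hence also `F (a 0) = 0`. The first row gives `F` at every `a
    -- p`, which includes the common `b s`; the first column gives the remaining `b s`.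
    obtain ⟨F, hFa, hFb⟩ := exists_extension_of_compatible hainj hbinj
      (fun p => c 0 * (conj (a p) - conj (b 0)) * r 0 p)
      (fun s => if hs : (s : ℕ) < l then
          c 0 * (conj (b s) - conj (b 0)) * r 0 (Fin.castLE hlm ⟨s, hs⟩)
        else -(c s * (conj (a 0) - conj (b s)) * r s 0))
      (fun p s hps => by
        obtain ⟨i, rfl, rfl⟩ := eq_castLE_of_apply_eq hbinj hcommon honly hps
        rw [dif_pos (show ((Fin.castLE hln i : Fin n) : ℕ) < l from i.2), hps]
        rfl)
    refine ⟨F, fun p s => ?_⟩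
    by_cases hps : a p = b s
    · rw [hps]
      ring
    rw [hFa, hFb]
    by_cases hs : (s : ℕ) < l
    · obtain ⟨i, rfl⟩ : ∃ i : Fin l, s = Fin.castLE hln i := ⟨⟨s, hs⟩, rfl⟩
      have hip : (i : ℕ) ≠ (p : ℕ) := fun h => hps (by
        rw [← hcommon i]
        exact congrArg a (Fin.ext h.symm))
      have h := (eq_div_iff (hne p i hip)).1 (h1 p i hip)
      rw [h00] at h
      rw [dif_pos hs]
      change _ = _ - c 0 * (conj (b (Fin.castLE hln i)) - conj (b 0)) * r 0 (Fin.castLE hlm i)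
      linear_combination h
    · have h := (eq_div_iff (hne' p s (not_lt.1 hs))).1 (h2 p s (not_lt.1 hs))
      rw [dif_neg hs]
      linear_combination h

end DifferenceForm

/-! ### The theorem: both characterisations and uniqueness. -/

theorem theorem3p1 {m n : ℕ} [NeZero m] [NeZero n]
    (a : Fin m → ℂ) (b : Fin n → ℂ)
    (ha : ∀ i, ‖a i‖ < 1) (hb : ∀ j, ‖b j‖ < 1)
    (ha_inj : Function.Injective a) (hb_inj : Function.Injective b)
    -- precisely `l` common zeros, namely `a i = b i` for the first `l` indices
    (l : ℕ) (hlm : l ≤ m) (hln : l ≤ n)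
    (hcommon : ∀ i : Fin l, a (Fin.castLE hlm i) = b (Fin.castLE hln i))
    (honly : ∀ (p : Fin m) (s : Fin n), a p = b s → (p : ℕ) < l) :
    -- the kernel bases of the two model spaces
    ∃ (u : Module.Basis (Fin m) ℂ (modelSpace (blaschke a)))
      (v : Module.Basis (Fin n) ℂ (modelSpace (blaschke b))),
      (∀ p, ((u p : LTwo) : UCircle → ℂ) =ᵐ[circleMeasure]
        onCircle (modelKernel (blaschke a) (a p))) ∧
      (∀ s, ((v s : LTwo) : UCircle → ℂ) =ᵐ[circleMeasure]
        onCircle (modelKernel (blaschke b) (b s))) ∧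
      -- (a) no common zeros
      (l = 0 →
        (∀ (A : modelSpace (blaschke a) →ₗ[ℂ] modelSpace (blaschke b))
            (r : Matrix (Fin n) (Fin m) ℂ), r = LinearMap.toMatrix u v A →
          (A ∈ asymTruncToeplitz (blaschke a) (blaschke b) ↔
            ∀ (p : Fin m) (s : Fin n),
              r s p =
                (conj (deriv (blaschke b) (b s)) * (conj (a 0) - conj (b s)) * r s 0
                  + conj (deriv (blaschke b) (b 0)) * (conj (b 0) - conj (a 0)) * r 0 0
                  + conj (deriv (blaschke b) (b 0)) * (conj (a p) - conj (b 0)) * r 0 p)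
                / (conj (deriv (blaschke b) (b s)) * (conj (a p) - conj (b s))))) ∧
        -- first row and first column determine the operator
        (∀ A ∈ asymTruncToeplitz (blaschke a) (blaschke b),
          ∀ A' ∈ asymTruncToeplitz (blaschke a) (blaschke b),
            (∀ p, LinearMap.toMatrix u v A 0 p = LinearMap.toMatrix u v A' 0 p) →
            (∀ s, LinearMap.toMatrix u v A s 0 = LinearMap.toMatrix u v A' s 0) →
            A = A')) ∧
      -- (b) some common zeros
      (0 < l →
        (∀ (A : modelSpace (blaschke a) →ₗ[ℂ] modelSpace (blaschke b))
            (r : Matrix (Fin n) (Fin m) ℂ), r = LinearMap.toMatrix u v A →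
          (A ∈ asymTruncToeplitz (blaschke a) (blaschke b) ↔
            (∀ (p : Fin m) (s : Fin l), (s : ℕ) ≠ (p : ℕ) →
              r (Fin.castLE hln s) p =
                (conj (deriv (blaschke b) (b 0)) * (conj (a 0) - conj (b (Fin.castLE hln s)))
                    * r 0 (Fin.castLE hlm s)
                  + conj (deriv (blaschke b) (b 0)) * (conj (a p) - conj (b 0)) * r 0 p)
                / (conj (deriv (blaschke b) (b (Fin.castLE hln s)))
                    * (conj (a p) - conj (b (Fin.castLE hln s))))) ∧
            (∀ (p : Fin m) (s : Fin n), l ≤ (s : ℕ) →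
              r s p =
                (conj (deriv (blaschke b) (b s)) * (conj (a 0) - conj (b s)) * r s 0
                  + conj (deriv (blaschke b) (b 0)) * (conj (a p) - conj (b 0)) * r 0 p)
                / (conj (deriv (blaschke b) (b s)) * (conj (a p) - conj (b s)))))) ∧
        -- first row, first `l` diagonal entries and last `n - l` entries of the first column
        -- determine the operator
        (∀ A ∈ asymTruncToeplitz (blaschke a) (blaschke b),
          ∀ A' ∈ asymTruncToeplitz (blaschke a) (blaschke b),
            (∀ p, LinearMap.toMatrix u v A 0 p = LinearMap.toMatrix u v A' 0 p) →
            (∀ i : Fin l, LinearMap.toMatrix u v A (Fin.castLE hln i) (Fin.castLE hlm i) =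
              LinearMap.toMatrix u v A' (Fin.castLE hln i) (Fin.castLE hlm i)) →
            (∀ s : Fin n, l ≤ (s : ℕ) →
              LinearMap.toMatrix u v A s 0 = LinearMap.toMatrix u v A' s 0) →
            A = A')) := by
  have hc : ∀ s, conj (deriv (blaschke b) (b s)) ≠ 0 := fun s =>
    (map_ne_zero _).2 (deriv_blaschke_ne_zero hb hb_inj s)
  refine ⟨szegoBasis ha ha_inj, szegoBasis hb hb_inj, fun p => ?_, fun s => ?_, fun hl => ?_,
    fun hl => ?_⟩
  · rw [modelKernel_blaschke_apply_zero]
    exact coeFn_szegoBasis ha ha_inj p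
  · rw [modelKernel_blaschke_apply_zero]
    exact coeFn_szegoBasis hb hb_inj s
  · have hab : ∀ p s, a p ≠ b s := fun p s h => by
      have := honly p s h
      omega
    have key := fun A => (mem_asymTruncToeplitz_iff_exists_difference ha hb ha_inj hb_inj A).trans
      (exists_difference_iff_of_disjoint ha_inj hb_inj hc hab _)
    refine ⟨fun A r hr => hr ▸ key A, fun A hA A' hA' hrow hcol => ?_⟩
    refine (LinearMap.toMatrix (szegoBasis ha ha_inj) (szegoBasis hb hb_inj)).injective ?_
    ext s p
    rw [(key A).1 hA p s, (key A').1 hA' p s, hrow 0, hrow p, hcol s]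
  · have key := fun A => (mem_asymTruncToeplitz_iff_exists_difference ha hb ha_inj hb_inj A).trans
      (exists_difference_iff_of_common ha_inj hb_inj hc hl hcommon honly _)
    refine ⟨fun A r hr => hr ▸ key A, fun A hA A' hA' hrow hdiag hcol => ?_⟩
    refine (LinearMap.toMatrix (szegoBasis ha ha_inj) (szegoBasis hb hb_inj)).injective ?_
    ext s p
    by_cases hs : (s : ℕ) < l
    · obtain ⟨i, rfl⟩ : ∃ i : Fin l, s = Fin.castLE hln i := ⟨⟨s, hs⟩, rfl⟩
      -- The first `l` diagonal entries are not governed by any formula, so their equality is taken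
      -- from the data.
      by_cases hip : (i : ℕ) = (p : ℕ)
      · obtain rfl : p = Fin.castLE hlm i := Fin.ext hip.symm
        exact hdiag i
      · rw [((key A).1 hA).1 p i hip, ((key A').1 hA').1 p i hip, hrow, hrow]
    · rw [((key A).1 hA).2 p s (not_lt.1 hs), ((key A').1 hA').2 p s (not_lt.1 hs), hrow p,
        hcol s (not_lt.1 hs)]
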